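/- Let $S$ be a connected closed surface, $V\subset S$ a finite set, and $\mathcal T=(V,E,F)$ a triangulation of $(S,V)$ (finitely many triangles whose sides are glued together; loops and multiple edges are allowed). A PH (piecewise hyperbolic) metric on $(S,V,\mathcal T)$ is a map $d:E\to(0,\infty)$ whose values on the three sides of every face satisfy the strict triangle inequalities, so that every face becomes a hyperbolic triangle. Its classical combinatorial curvature at $v_i\in V$ is $K_i=2\pi-\sum\theta$, where $\theta$ runs over the inner angles at all corners of faces located at $v_i$. For $u:V\to\mathbb R$, the vertex scaling $u*d$ is given by $$\sinh\frac{(u*d)_{ij}}2=e^{u_i+u_j}\sinh\frac{d_{ij}}2\qquad\text{for every edge } v_iv_j\in E .$$ The admissible space $\mathcal U(d)\subset\mathbb R^V$ is the set of all $u$ for which $u*d$ is again a PH metric, i.e. satisfies the strict triangle inequalities in every face; its elements are called discrete conformal factors for $d$. For $\alpha\in\mathbb R$ and $u\in\mathcal U(d)$, the combinatorial $\alpha$-curvature of $u*d$ is $R_{\alpha,i}=K_i(u*d)/e^{\alpha u_i}$. For arbitrary $u\in\mathbb R^V$, the extended inner angles of a face are its inner angles in $u*d$ if the strict triangle inequalities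 hold there; if one side of the face is at least as long as the sum of the two others, the extended angle opposite to that side is $\pi$ and the two others are $0$ (these are continuous functions of $u$). Let $\widetilde K_i$ be the curvature formed with the extended angles and $\widetilde R_{\alpha,i}(u)=\widetilde K_i(u)/e^{\alpha u_i}$ the extended combinatorial $\alpha$-curvature. Theorem. Let $d_0$ be a PH metric on $(S,V,\mathcal T)$, $\alpha\in\mathbb R$ and $\overline R:V\to\mathbb R$ with $\alpha\overline R_i\le 0$ for all $v_i\in V$. (1) There is at most one discrete conformal factor $u\in\mathcal U(d_0)$ such that the combinatorial $\alpha$-curvature of $u*d_0$ is $\overline R$. (2) If $u_A\in\mathcal U(d_0)$ and $u_B\in\mathbb R^V$ satisfy $\widetilde R_\alpha(u_A)=\widetilde R_\alpha(u_B)=\overline R$, then $u_A=u_B$. -/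

import Mathlib

/-- The open simplex with vertex set `Fin n`: all barycentric coordinates are positive. -/
abbrev OpenSimplex (n : ℕ) : Type :=
  {x : stdSimplex ℝ (Fin n) // ∀ i, 0 < x i}

/-- A (finite) triangulation `𝒯 = (V, E, F)` of a marked surface `(S, V)`, given by
characteristic maps of its edges and faces.  Every side of a face is glued affinely onto an
edge, and `S` is the disjoint union of `V`, the open edges and the open faces, each of which
is embedded by its characteristic map.  Several vertices of a face may coincide,
loops and multiple edges are allowed, so that this covers both simplicial
complexes and the general triangulations of marked surfaces. -/
structure Triangulation (S : Type*) [TopologicalSpace S] (V : Finset S) where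
  /-- the set `E` of edges -/
  Edge : Type
  /-- the set `F` of faces -/
  Face : Type
  [fintypeEdge : Fintype Edge]
  [fintypeFace : Fintype Face]
  /-- the characteristic map of an edge -/
  edgeMap : Edge → C(stdSimplex ℝ (Fin 2), S)
  /-- the characteristic map of a face -/
  faceMap : Face → C(stdSimplex ℝ (Fin 3), S)
  edgeMap_vertex_mem : ∀ e i, edgeMap e (stdSimplex.vertex i) ∈ V
  faceMap_vertex_mem : ∀ f i, faceMap f (stdSimplex.vertex i) ∈ V
  /-- `side f i` is the edge onto which the side of `f` opposite to the corner `i` is glued -/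
  side : Face → Fin 3 → Edge
  /-- the side of `f` opposite to the corner `i` is the edge `side f i`, with one of its two
  orientations -/
  faceMap_side : ∀ f i, ∃ π : Equiv.Perm (Fin 2), ∀ x : stdSimplex ℝ (Fin 2),
    faceMap f (stdSimplex.map i.succAbove x) = edgeMap (side f i) (stdSimplex.map π x)
  /-- `S` is the disjoint union of the vertices, the open edges and the open faces -/
  bijective_cells : Function.Bijective
    (Sum.elim (fun v : V => (v : S))
      (Sum.elim (fun p : Edge × OpenSimplex 2 => edgeMap p.1 p.2.1)
        (fun p : Face × OpenSimplex 3 => faceMap p.1 p.2.1)))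
  /-- every vertex is a corner of a face -/
  exists_corner : ∀ v ∈ V, ∃ f i, faceMap f (stdSimplex.vertex i) = v
  /-- every edge is a side of a face -/
  exists_side : ∀ e, ∃ f i, side f i = e

/-- The inner angle, opposite to the side of length `a`, of the hyperbolic triangle with side
lengths `a`, `b`, `c` (which satisfy the strict triangle inequalities), as given by the
hyperbolic law of cosines `cosh a = cosh b * cosh c - sinh b * sinh c * cos θ`. -/
noncomputable def hypAngle (a b c : ℝ) : ℝ :=
  Real.arccos ((Real.cosh b * Real.cosh c - Real.cosh a) / (Real.sinh b * Real.sinh c))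

/-- The extension of `hypAngle` by constants to all triples of positive reals: if a triangle
inequality fails, the angle opposite to the too long side is `π`, the two others are `0`. -/
noncomputable def extHypAngle (a b c : ℝ) : ℝ :=
  if b + c ≤ a then Real.pi
  else if c + a ≤ b ∨ a + b ≤ c then 0
  else hypAngle a b c

theorem extHypAngle_eq_hypAngle {a b c : ℝ} (ha : 0 < a) (hb : 0 < b) (hc : 0 < c) :
    extHypAngle a b c = hypAngle a b c := by
  have hs : 0 < Real.sinh b * Real.sinh c :=
    mul_pos (Real.sinh_pos_iff.2 hb) (Real.sinh_pos_iff.2 hc)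
  unfold extHypAngle
  split_ifs with h1 h2
  · have h : Real.cosh (b + c) ≤ Real.cosh a :=
      Real.cosh_le_cosh.2 (by rwa [abs_of_pos (by linarith), abs_of_pos ha])
    rw [Real.cosh_add] at h
    exact (Real.arccos_of_le_neg_one (by rw [div_le_iff₀ hs]; linarith)).symm
  · have h : Real.cosh a ≤ Real.cosh (b - c) := by
      rw [Real.cosh_le_cosh, abs_of_pos ha]
      rcases h2 with h | h
      · exact le_trans (by linarith) (le_abs_self _)
      · exact le_trans (by linarith) (neg_le_abs _)
    rw [Real.cosh_sub] at h
    exact (Real.arccos_of_one_le (by rw [le_div_iff₀ hs]; linarith)).symm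
  · rfl

namespace Triangulation

variable {S : Type*} [TopologicalSpace S] {V : Finset S}

attribute [instance] Triangulation.fintypeEdge Triangulation.fintypeFace

/-- The `i`-th end point of an edge. -/
def endpoint (T : Triangulation S V) (e : T.Edge) (i : Fin 2) : V :=
  ⟨T.edgeMap e (stdSimplex.vertex i), T.edgeMap_vertex_mem e i⟩

/-- The vertex at the `i`-th corner of a face. -/
def corner (T : Triangulation S V) (f : T.Face) (i : Fin 3) : V :=
  ⟨T.faceMap f (stdSimplex.vertex i), T.faceMap_vertex_mem f i⟩

open scoped Classical in
/-- The sum of the values `θ f i` over all corners `(f, i)` of faces that lie at `v`. -/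
noncomputable def cornerSum (T : Triangulation S V) (θ : T.Face → Fin 3 → ℝ) (v : V) : ℝ :=
  ∑ f : T.Face, ∑ i : Fin 3, if T.corner f i = v then θ f i else 0

/-- A PH metric on a triangulated surface: positive edge lengths that satisfy the strict
triangle inequalities in every face. -/
structure PHMetric (T : Triangulation S V) where
  length : T.Edge → ℝ
  length_pos : ∀ e, 0 < length e
  triangle_lt : ∀ f i,
    length (T.side f i) < length (T.side f (i + 1)) + length (T.side f (i + 2))

namespace PHMetric

variable {T : Triangulation S V}

/-- The inner angle at the corner `i` of the face `f`. -/
noncomputable def angle (d : T.PHMetric) (f : T.Face) (i : Fin 3) : ℝ :=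
  hypAngle (d.length (T.side f i)) (d.length (T.side f (i + 1))) (d.length (T.side f (i + 2)))

/-- The classical combinatorial curvature `K`. -/
noncomputable def curvature (d : T.PHMetric) (v : V) : ℝ :=
  2 * Real.pi - T.cornerSum d.angle v

/-- The edge lengths of the vertex scaling `u * d`. -/
noncomputable def scaledLength (d : T.PHMetric) (u : V → ℝ) (e : T.Edge) : ℝ :=
  2 * Real.arsinh
    (Real.sinh (d.length e / 2) * Real.exp (u (T.endpoint e 0) + u (T.endpoint e 1)))

theorem sinh_scaledLength (d : T.PHMetric) (u : V → ℝ) (e : T.Edge) :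
    Real.sinh (d.scaledLength u e / 2) =
      Real.sinh (d.length e / 2) * Real.exp (u (T.endpoint e 0) + u (T.endpoint e 1)) := by
  simp [scaledLength, mul_div_cancel_left₀]

theorem scaledLength_pos (d : T.PHMetric) (u : V → ℝ) (e : T.Edge) :
    0 < d.scaledLength u e := by
  have h := d.length_pos e
  have h' : 0 < Real.sinh (d.length e / 2) := Real.sinh_pos_iff.2 (by linarith)
  exact mul_pos two_pos (Real.arsinh_pos_iff.2 (mul_pos h' (Real.exp_pos _)))

/-- The admissible space of `d`: all `u` for which the lengths of `u * d` satisfy the strict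
triangle inequalities in every face. -/
def admissibleSpace (d : T.PHMetric) : Set (V → ℝ) :=
  {u | ∀ f i, d.scaledLength u (T.side f i) <
    d.scaledLength u (T.side f (i + 1)) + d.scaledLength u (T.side f (i + 2))}

/-- The vertex scaling `u * d`, a PH metric, by an admissible `u`. -/
noncomputable def scale (d : T.PHMetric) (u : d.admissibleSpace) : T.PHMetric where
  length := d.scaledLength u
  length_pos := d.scaledLength_pos u
  triangle_lt := u.2

/-- The combinatorial `α`-curvature of `u * d`, with `u` a discrete conformal factor for `d`. -/
noncomputable def alphaCurvature (d : T.PHMetric) (α : ℝ) (u : d.admissibleSpace) (v : V) : ℝ :=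
  (d.scale u).curvature v / Real.exp (u.1 v) ^ α

/-- The extended inner angle of `u * d` at the corner `i` of the face `f`, for arbitrary `u`. -/
noncomputable def extAngle (d : T.PHMetric) (u : V → ℝ) (f : T.Face) (i : Fin 3) : ℝ :=
  extHypAngle (d.scaledLength u (T.side f i)) (d.scaledLength u (T.side f (i + 1)))
    (d.scaledLength u (T.side f (i + 2)))

/-- `extAngle` extends the inner angles of `u * d` from the admissible space. -/
theorem extAngle_eq_angle (d : T.PHMetric) (u : d.admissibleSpace) :
    d.extAngle u.1 = (d.scale u).angle := by
  funext f i
  exact extHypAngle_eq_hypAngle (d.scaledLength_pos _ _) (d.scaledLength_pos _ _)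
    (d.scaledLength_pos _ _)

/-- The extended inner angles are continuous. -/
theorem continuous_extAngle (d : T.PHMetric) (f : T.Face) (i : Fin 3) :
    Continuous fun u => d.extAngle u f i := by
  have h : ∀ e, Continuous fun u => d.scaledLength u e := fun e => by
    unfold scaledLength
    exact continuous_const.mul (Real.continuous_arsinh.comp (by fun_prop))
  have h0 : ∀ e u, Real.sinh (d.scaledLength u e) ≠ 0 := fun e u =>
    (Real.sinh_pos_iff.2 (d.scaledLength_pos u e)).ne'
  have h1 : (fun u => d.extAngle u f i) = fun u => hypAngle (d.scaledLength u (T.side f i))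
      (d.scaledLength u (T.side f (i + 1))) (d.scaledLength u (T.side f (i + 2))) :=
    funext fun u => extHypAngle_eq_hypAngle (d.scaledLength_pos _ _)
      (d.scaledLength_pos _ _) (d.scaledLength_pos _ _)
  rw [h1]
  unfold hypAngle
  refine Real.continuous_arccos.comp (Continuous.div ?_ ?_ fun u => mul_ne_zero (h0 _ _) (h0 _ _))
  · exact ((Real.continuous_cosh.comp (h _)).mul (Real.continuous_cosh.comp (h _))).sub
      (Real.continuous_cosh.comp (h _))
  · exact (Real.continuous_sinh.comp (h _)).mul (Real.continuous_sinh.comp (h _))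

/-- The extended combinatorial curvature. -/
noncomputable def extCurvature (d : T.PHMetric) (u : V → ℝ) (v : V) : ℝ :=
  2 * Real.pi - T.cornerSum (d.extAngle u) v

/-- The extended combinatorial `α`-curvature. -/
noncomputable def extAlphaCurvature (d : T.PHMetric) (α : ℝ) (u : V → ℝ) (v : V) : ℝ :=
  d.extCurvature u v / Real.exp (u v) ^ α

end PHMetric

end Triangulation

/-! The extended curvature is a monotone map of `u`, strictly so when compared with an admissible
point (`sum_extCurvature_sub_mul_pos`), while `R * exp (α * u)` is nonincreasing in `u` because `α *
R ≤ 0`. If both sides agree at `uA` and `uB`, pairing their differences with `uB - uA` gives a sum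
that is both positive and nonpositive unless `uA = uB`.

Monotonicity is proved face by face, along the line from `u` to `u'`. Where a face has positive Gram
determinant, the pairing of its angles with the direction `h` has derivative `-2 / √G` times a
positive definite form (`scalingForm_pos`). Elsewhere its angles are `0` or `π`, so the pairing
takes one of finitely many values. A continuous function cannot climb through the gaps between those
values, whatever the set of degenerate parameters looks like; no convex potential has to be
extended. -/

/-! ### Monotone functions of one variable -/

open Filter Topology Set in
/-- A continuous function that has a negative derivative wherever its value lies outside a fixed
finite set is antitone. -/
theorem antitone_of_hasDerivAt_neg_or_mem_finite {g : ℝ → ℝ} (hg : Continuous g) {Z : Set ℝ}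
    (hZ : Z.Finite) (h : ∀ t, g t ∈ Z ∨ ∃ g' < 0, HasDerivAt g g' t) : Antitone g := by
  intro s t hst
  by_contra! hlt
  -- A rise from `g s` to `g t` crosses a level `y` outside `Z`. At the first time `r` with `g r ≥
  -- y` the derivative is negative, so `g` exceeds `y` already before `r`.
  obtain ⟨y, ⟨hy1, hy2⟩, hyZ⟩ := ((Ioo_infinite hlt).sdiff hZ).nonempty
  have hcomp : IsCompact (Icc s t ∩ g ⁻¹' Ici y) :=
    isCompact_Icc.inter_right (isClosed_Ici.preimage hg)
  obtain ⟨r, ⟨⟨hsr, hrt⟩, hry⟩, hmin⟩ := hcomp.exists_isLeast ⟨t, ⟨hst, le_rfl⟩, hy2.le⟩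
  have hry' : y ≤ g r := hry
  have hsr' : s < r := lt_of_le_of_ne hsr fun hsr => by subst hsr; linarith
  have hgr : g r = y := by
    obtain ⟨q, ⟨hq1, hq2⟩, hq⟩ := intermediate_value_Icc hsr hg.continuousOn ⟨hy1.le, hry'⟩
    have : r ≤ q := hmin ⟨⟨hq1, hq2.trans hrt⟩, hq.ge⟩
    rwa [le_antisymm hq2 this] at hq
  obtain hr | ⟨g', hg', hd⟩ := h r
  · exact hyZ (hgr ▸ hr)
  · have h1 : ∀ᶠ x in 𝓝[<] r, slope g r x < 0 :=
      ((hasDerivAt_iff_tendsto_slope.1 hd).mono_left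
        (nhdsWithin_mono r fun x hx => (ne_of_lt hx : x ≠ r))).eventually (gt_mem_nhds hg')
    obtain ⟨x, hx, hx1, hx2⟩ := (h1.and (Ioo_mem_nhdsLT hsr')).exists
    rw [slope_def_field, div_neg_iff] at hx
    have hgx : y ≤ g x := by rcases hx with hx | hx <;> linarith
    have : r ≤ x := hmin ⟨⟨hx1.le, hx2.le.trans hrt⟩, hgx⟩
    linarith

open Filter Topology Set in
theorem HasDerivAt.exists_mem_Ioo_lt_of_neg {g : ℝ → ℝ} {g' s t : ℝ} (hd : HasDerivAt g g' s)
    (hg' : g' < 0) (hst : s < t) : ∃ x ∈ Ioo s t, g x < g s := by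
  have h1 : ∀ᶠ x in 𝓝[>] s, slope g s x < 0 :=
    ((hasDerivAt_iff_tendsto_slope.1 hd).mono_left
      (nhdsWithin_mono s fun x hx => (ne_of_gt hx : x ≠ s))).eventually (gt_mem_nhds hg')
  obtain ⟨x, hx, hx'⟩ := (h1.and (Ioo_mem_nhdsGT hst)).exists
  refine ⟨x, hx', ?_⟩
  rw [slope_def_field, div_neg_iff] at hx
  rcases hx with hx | hx <;> linarith [hx'.1]

/-! ### Positive definiteness of the angle Jacobian -/

/-- Sylvester's criterion for a symmetric `3 × 3` matrix. -/
theorem quadraticForm_pos_of_minors_pos {a b c p q r : ℝ} (hc : 0 < c) (hac : 0 < a * c - q ^ 2)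
    (hdet : 0 < a * b * c + 2 * p * q * r - a * r ^ 2 - b * q ^ 2 - c * p ^ 2)
    {x y z : ℝ} (h : x ≠ 0 ∨ y ≠ 0 ∨ z ≠ 0) :
    0 < a * x ^ 2 + b * y ^ 2 + c * z ^ 2 + 2 * p * x * y + 2 * q * x * z + 2 * r * y * z := by
  -- Completing the square in the order `z`, `x`, `y`, with denominators cleared.
  have key : c * (a * c - q ^ 2) *
      (a * x ^ 2 + b * y ^ 2 + c * z ^ 2 + 2 * p * x * y + 2 * q * x * z + 2 * r * y * z) =
      (a * c - q ^ 2) * (q * x + r * y + c * z) ^ 2 +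
      ((a * c - q ^ 2) * x + (p * c - q * r) * y) ^ 2 +
      c * (a * b * c + 2 * p * q * r - a * r ^ 2 - b * q ^ 2 - c * p ^ 2) * y ^ 2 := by ring
  refine pos_of_mul_pos_right (a := c * (a * c - q ^ 2)) ?_ (by positivity)
  rw [key]
  by_cases hy : y = 0
  · by_cases hx : x = 0
    · have hz : z ≠ 0 := by tauto
      subst hx hy
      have : 0 < (a * c - q ^ 2) * (c * z) ^ 2 := by positivity
      simpa using this
    · subst hy
      have : 0 < ((a * c - q ^ 2) * x) ^ 2 := by positivity
      have h2 : 0 ≤ (a * c - q ^ 2) * (q * x + r * 0 + c * z) ^ 2 := by positivity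
      simp only [mul_zero, add_zero] at *
      nlinarith
  · positivity

/-- The quadratic form of the Jacobian of the angles of a hyperbolic triangle under vertex
scaling, in terms of `x = sinh (a / 2) ^ 2`, `y = sinh (b / 2) ^ 2` and `z = sinh (c / 2) ^ 2`. -/
noncomputable def scalingForm (x y z h₁ h₂ h₃ : ℝ) : ℝ :=
  (y + z - x) * ((h₂ - h₃) ^ 2 + x / (1 + x) * (h₂ + h₃) ^ 2) +
  (z + x - y) * ((h₃ - h₁) ^ 2 + y / (1 + y) * (h₃ + h₁) ^ 2) +
  (x + y - z) * ((h₁ - h₂) ^ 2 + z / (1 + z) * (h₁ + h₂) ^ 2)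

/-- Coefficients such as `y + z - x` may be negative, so the form is not visibly a sum of squares.
Its leading minors, however, factor through `D`, a quarter of the Gram determinant; the full
determinant is `4 * D ^ 2` over a positive product. -/
theorem scalingForm_pos {x y z : ℝ} (hx : 0 < x) (hy : 0 < y) (hz : 0 < z)
    (hD : 0 < 2 * (x * y + y * z + z * x) - x ^ 2 - y ^ 2 - z ^ 2 + 4 * x * y * z)
    {h₁ h₂ h₃ : ℝ} (h : h₁ ≠ 0 ∨ h₂ ≠ 0 ∨ h₃ ≠ 0) : 0 < scalingForm x y z h₁ h₂ h₃ := by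
  set D := 2 * (x * y + y * z + z * x) - x ^ 2 - y ^ 2 - z ^ 2 + 4 * x * y * z with hDdef
  have hx' : 1 + x ≠ 0 := by positivity
  have hy' : 1 + y ≠ 0 := by positivity
  have hz' : 1 + z ≠ 0 := by positivity
  -- The factor left over in the `2 × 2` minor. Were it nonpositive, `y` would be so large compared
  -- with `x` and `z` that `D < 0`.
  have hg : 0 < 1 - y + 3 * x + 3 * z + 4 * x * z := by
    by_contra! hg
    have hm : 1 + 2 * x + 2 * z + 2 * x * z ≤ y - x - z - 2 * x * z := by linarith
    have hm2 := pow_le_pow_left₀ (by positivity) hm 2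
    have e : D = 4 * x * z * (1 + x) * (1 + z) - (y - x - z - 2 * x * z) ^ 2 := by
      rw [hDdef]
      ring
    have : 0 < 1 + 4 * x ^ 2 + 4 * z ^ 2 + 4 * x + 4 * z + 8 * x * z + 4 * x ^ 2 * z +
      4 * x * z ^ 2 := by positivity
    nlinarith
  have key := quadraticForm_pos_of_minors_pos
    (a := 4 * x - (z + x - y) / (1 + y) - (x + y - z) / (1 + z))
    (b := 4 * y - (x + y - z) / (1 + z) - (y + z - x) / (1 + x))
    (c := 4 * z - (y + z - x) / (1 + x) - (z + x - y) / (1 + y))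
    (p := -((x + y - z) / (1 + z))) (q := -((z + x - y) / (1 + y)))
    (r := -((y + z - x) / (1 + x))) ?_ ?_ ?_ h
  · refine key.trans_eq ?_
    unfold scalingForm
    field_simp
    ring
  · have : 4 * z - (y + z - x) / (1 + x) - (z + x - y) / (1 + y) =
        (2 * z + (x + y) * z + z ^ 2 + D) / ((1 + x) * (1 + y)) := by
      field_simp
      rw [hDdef]
      ring
    rw [this]
    positivity
  · refine lt_of_lt_of_eq
      (b := D * (1 - y + 3 * x + 3 * z + 4 * x * z) / ((1 + x) * (1 + y) * (1 + z))) (by positivity) ?_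
    field_simp
    rw [hDdef]
    ring
  · refine lt_of_lt_of_eq
      (b := 4 * D ^ 2 / ((1 + x) * (1 + y) * (1 + z))) (by positivity) ?_
    field_simp
    rw [hDdef]
    ring

/-! ### Variation of hyperbolic triangles -/

/-- The Gram determinant `1 + 2ABC - A² - B² - C²`, with `A`, `B`, `C` the hyperbolic cosines of
the sides of a triangle. -/
noncomputable def hypGram (a b c : ℝ) : ℝ :=
  1 + 2 * Real.cosh a * Real.cosh b * Real.cosh c
    - Real.cosh a ^ 2 - Real.cosh b ^ 2 - Real.cosh c ^ 2

theorem hypGram_rotate (a b c : ℝ) : hypGram b c a = hypGram a b c := by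
  unfold hypGram
  ring

theorem hypGram_eq (a b c : ℝ) :
    hypGram a b c = (Real.sinh b * Real.sinh c) ^ 2 -
      (Real.cosh b * Real.cosh c - Real.cosh a) ^ 2 := by
  unfold hypGram
  rw [mul_pow, Real.sinh_sq, Real.sinh_sq]
  ring

theorem hypGram_pos {a b c : ℝ} (ha : 0 < a) (hb : 0 < b) (hc : 0 < c) (h₁ : a < b + c)
    (h₂ : b < c + a) (h₃ : c < a + b) : 0 < hypGram a b c := by
  have h4 : Real.cosh a < Real.cosh (b + c) := by
    rw [Real.cosh_lt_cosh, abs_of_pos ha, abs_of_pos (by linarith)]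
    exact h₁
  have h5 : Real.cosh (b - c) < Real.cosh a := by
    rw [Real.cosh_lt_cosh, abs_of_pos ha, abs_lt]
    constructor <;> linarith
  rw [Real.cosh_add] at h4
  rw [Real.cosh_sub] at h5
  rw [hypGram_eq, sub_pos, sq_lt_sq, abs_of_pos (mul_pos (Real.sinh_pos_iff.2 hb)
    (Real.sinh_pos_iff.2 hc)), abs_lt]
  constructor <;> linarith

/-- A nonpositive Gram determinant says that the argument of `Real.arccos` has absolute value at
least `1`. -/
theorem hypAngle_eq_zero_or_pi {a b c : ℝ} (hb : 0 < b) (hc : 0 < c) (h : hypGram a b c ≤ 0) :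
    hypAngle a b c = 0 ∨ hypAngle a b c = Real.pi := by
  have hs : 0 < Real.sinh b * Real.sinh c :=
    mul_pos (Real.sinh_pos_iff.2 hb) (Real.sinh_pos_iff.2 hc)
  rw [hypGram_eq, sub_nonpos, sq_le_sq, abs_of_pos hs, le_abs] at h
  rcases h with h | h
  · exact .inl (Real.arccos_of_one_le (by rwa [le_div_iff₀ hs, one_mul]))
  · exact .inr (Real.arccos_of_le_neg_one (by rw [div_le_iff₀ hs]; linarith))

/-- The variation of an angle under vertex scaling, where `wa` is the sum of the variations of the
conformal factor at the two ends of the side `a`, and so on. -/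
theorem hasDerivAt_hypAngle {a b c : ℝ → ℝ} {t wa wb wc : ℝ}
    (ha : 0 < a t) (hb : 0 < b t) (hc : 0 < c t)
    (ha' : HasDerivAt a (2 * wa * (Real.cosh (a t) - 1) / Real.sinh (a t)) t)
    (hb' : HasDerivAt b (2 * wb * (Real.cosh (b t) - 1) / Real.sinh (b t)) t)
    (hc' : HasDerivAt c (2 * wc * (Real.cosh (c t) - 1) / Real.sinh (c t)) t)
    (hG : 0 < hypGram (a t) (b t) (c t)) :
    HasDerivAt (fun s => hypAngle (a s) (b s) (c s))
      (2 / √(hypGram (a t) (b t) (c t)) * (wa * (Real.cosh (a t) - 1)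
        - wb * ((Real.cosh (a t) * Real.cosh (b t) - Real.cosh (c t)) / (1 + Real.cosh (b t)))
        - wc * ((Real.cosh (a t) * Real.cosh (c t) - Real.cosh (b t)) / (1 + Real.cosh (c t)))))
      t := by
  have hsa : 0 < Real.sinh (a t) := Real.sinh_pos_iff.2 ha
  have hsb : 0 < Real.sinh (b t) := Real.sinh_pos_iff.2 hb
  have hsc : 0 < Real.sinh (c t) := Real.sinh_pos_iff.2 hc
  have hN := ((hb'.cosh.fun_mul hc'.cosh).fun_sub ha'.cosh).fun_div (hb'.sinh.fun_mul hc'.sinh)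
    (mul_pos hsb hsc).ne'
  have hroot := Real.sqrt_pos.2 hG
  have h1 : 1 - ((Real.cosh (b t) * Real.cosh (c t) - Real.cosh (a t)) /
      (Real.sinh (b t) * Real.sinh (c t))) ^ 2 =
      hypGram (a t) (b t) (c t) / (Real.sinh (b t) * Real.sinh (c t)) ^ 2 := by
    rw [hypGram_eq]
    field_simp
  have hlt : ((Real.cosh (b t) * Real.cosh (c t) - Real.cosh (a t)) /
      (Real.sinh (b t) * Real.sinh (c t))) ^ 2 < 1 := by
    rw [← sub_pos, h1]
    positivity
  rw [sq_lt_one_iff_abs_lt_one, abs_lt] at hlt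
  have := (Real.hasDerivAt_arccos hlt.1.ne' hlt.2.ne).comp t hN
  refine this.congr_deriv ?_
  rw [h1, Real.sqrt_div' _ (sq_nonneg _), Real.sqrt_sq (mul_pos hsb hsc).le]
  have eb := Real.sinh_sq (b t)
  have ec := Real.sinh_sq (c t)
  have hcb : 0 < 1 + Real.cosh (b t) := by linarith [Real.cosh_pos (b t)]
  have hcc : 0 < 1 + Real.cosh (c t) := by linarith [Real.cosh_pos (c t)]
  generalize √(hypGram (a t) (b t) (c t)) = G at *
  generalize Real.sinh (a t) = sa at *
  generalize Real.sinh (b t) = sb at *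
  generalize Real.sinh (c t) = sc at *
  generalize Real.cosh (a t) = A at *
  generalize Real.cosh (b t) = B at *
  generalize Real.cosh (c t) = C at *
  -- The numerator of the quotient rule; `hB` and `hC` equate two expressions for the hyperbolic
  -- tangent of half a side.
  have e1 : (sb * (2 * wb * (B - 1) / sb) * C + B * (sc * (2 * wc * (C - 1) / sc)) -
      sa * (2 * wa * (A - 1) / sa)) * (sb * sc) -
      (B * C - A) * (B * (2 * wb * (B - 1) / sb) * sc + sb * (C * (2 * wc * (C - 1) / sc))) =
      sb * sc * (-2 * (wa * (A - 1) - wb * ((A * B - C) / (1 + B))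
        - wc * ((A * C - B) / (1 + C)))) := by
    have hB : (B - 1) / sb = sb / (1 + B) := by
      rw [div_eq_div_iff hsb.ne' hcb.ne']
      linarith
    have hC : (C - 1) / sc = sc / (1 + C) := by
      rw [div_eq_div_iff hsc.ne' hcc.ne']
      linarith
    have e2 : sb * (2 * wb * (B - 1) / sb) = 2 * wb * (B - 1) := by field_simp
    have e3 : sc * (2 * wc * (C - 1) / sc) = 2 * wc * (C - 1) := by field_simp
    have e4 : sa * (2 * wa * (A - 1) / sa) = 2 * wa * (A - 1) := by field_simp
    have e5 : B * (2 * wb * (B - 1) / sb) = 2 * wb * B * (sb / (1 + B)) := by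
      rw [← hB]
      ring
    have e6 : C * (2 * wc * (C - 1) / sc) = 2 * wc * C * (sc / (1 + C)) := by
      rw [← hC]
      ring
    rw [e2, e3, e4, e5, e6]
    field_simp
    ring
  rw [e1]
  field_simp

/-- The angles of a hyperbolic triangle vary monotonically under vertex scaling. -/
theorem exists_hasDerivAt_angles_neg {a b c : ℝ → ℝ} {t h₁ h₂ h₃ : ℝ}
    (ha : 0 < a t) (hb : 0 < b t) (hc : 0 < c t)
    (ha' : HasDerivAt a (2 * (h₂ + h₃) * (Real.cosh (a t) - 1) / Real.sinh (a t)) t)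
    (hb' : HasDerivAt b (2 * (h₃ + h₁) * (Real.cosh (b t) - 1) / Real.sinh (b t)) t)
    (hc' : HasDerivAt c (2 * (h₁ + h₂) * (Real.cosh (c t) - 1) / Real.sinh (c t)) t)
    (hG : 0 < hypGram (a t) (b t) (c t)) (h : h₁ ≠ 0 ∨ h₂ ≠ 0 ∨ h₃ ≠ 0) :
    ∃ g' < 0, HasDerivAt (fun s => hypAngle (a s) (b s) (c s) * h₁ +
      hypAngle (b s) (c s) (a s) * h₂ + hypAngle (c s) (a s) (b s) * h₃) g' t := by
  have h1 := hasDerivAt_hypAngle ha hb hc ha' hb' hc' hG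
  have h2 := hasDerivAt_hypAngle hb hc ha hb' hc' ha' (by rwa [hypGram_rotate])
  have h3 := hasDerivAt_hypAngle hc ha hb hc' ha' hb' (by rwa [hypGram_rotate, hypGram_rotate])
  refine ⟨_, ?_, ((h1.mul_const h₁).fun_add (h2.mul_const h₂)).fun_add (h3.mul_const h₃)⟩
  rw [hypGram_rotate, hypGram_rotate, hypGram_rotate]
  have hA := Real.one_lt_cosh.2 ha.ne'
  have hB := Real.one_lt_cosh.2 hb.ne'
  have hC := Real.one_lt_cosh.2 hc.ne'
  have hroot := Real.sqrt_pos.2 hG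
  have hpos := scalingForm_pos (x := (Real.cosh (a t) - 1) / 2) (y := (Real.cosh (b t) - 1) / 2)
    (z := (Real.cosh (c t) - 1) / 2) (by linarith) (by linarith) (by linarith)
    (by unfold hypGram at hG; linarith) h
  rw [← neg_pos]
  -- The derivative is exactly `-2 / √G` times `scalingForm`.
  refine lt_of_lt_of_eq (mul_pos (div_pos two_pos hroot) hpos) ?_
  unfold scalingForm
  generalize √(hypGram (a t) (b t) (c t)) = G at *
  generalize Real.cosh (a t) = A at *
  generalize Real.cosh (b t) = B at *
  generalize Real.cosh (c t) = C at *
  have hA' : A + 1 ≠ 0 := by linarith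
  have hB' : B + 1 ≠ 0 := by linarith
  have hC' : C + 1 ≠ 0 := by linarith
  have e (X : ℝ) : (X - 1) / 2 / (1 + (X - 1) / 2) = (X - 1) / (X + 1) := by
    rw [show 1 + (X - 1) / 2 = (X + 1) / 2 by ring, div_div_div_cancel_right₀ two_ne_zero]
  rw [e, e, e, add_comm 1 A, add_comm 1 B, add_comm 1 C]
  field_simp
  ring

/-- The length of an edge under vertex scaling along a line. -/
theorem hasDerivAt_two_mul_arsinh {k : ℝ} (hk : 0 < k) (p w t : ℝ) :
    HasDerivAt (fun s => 2 * Real.arsinh (k * Real.exp (p + s * w)))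
      (2 * w * (Real.cosh (2 * Real.arsinh (k * Real.exp (p + t * w))) - 1) /
        Real.sinh (2 * Real.arsinh (k * Real.exp (p + t * w)))) t := by
  have h1 : HasDerivAt (fun s => k * Real.exp (p + s * w))
      (k * (Real.exp (p + t * w) * (1 * w))) t :=
    (((hasDerivAt_id' t).mul_const w).const_add p).exp.const_mul k
  refine (h1.arsinh.const_mul 2).congr_deriv ?_
  have hy : 0 < k * Real.exp (p + t * w) := by positivity
  rw [Real.cosh_two_mul, Real.sinh_two_mul, Real.cosh_sq, Real.sinh_arsinh, Real.cosh_arsinh]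
  have : 0 < √(1 + (k * Real.exp (p + t * w)) ^ 2) := by positivity
  rw [smul_eq_mul]
  field_simp
  ring

/-! ### Angle pairings on the triangulation -/

namespace Triangulation

variable {S : Type*} [TopologicalSpace S] {V : Finset S}

/-- The sum is symmetric, so the orientation with which a side is glued does not matter. -/
theorem endpoint_add_endpoint (T : Triangulation S V) (φ : V → ℝ) (f : T.Face) (i : Fin 3) :
    φ (T.endpoint (T.side f i) 0) + φ (T.endpoint (T.side f i) 1) =
      φ (T.corner f (i + 1)) + φ (T.corner f (i + 2)) := by
  obtain ⟨π, hπ⟩ := T.faceMap_side f i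
  have h (j : Fin 2) : T.corner f (i.succAbove j) = T.endpoint (T.side f i) (π j) := by
    have := hπ (stdSimplex.vertex j)
    rw [stdSimplex.map_vertex, stdSimplex.map_vertex] at this
    exact Subtype.ext this
  have hsum : ∑ j, φ (T.corner f (i.succAbove j)) = ∑ j, φ (T.endpoint (T.side f i) j) := by
    simp_rw [h]
    exact Equiv.sum_comp π fun j => φ (T.endpoint (T.side f i) j)
  rw [Fin.sum_univ_two, Fin.sum_univ_two] at hsum
  rw [← hsum]
  fin_cases i
  · rfl
  · exact add_comm _ _
  · rfl

theorem sum_cornerSum_mul (T : Triangulation S V) (θ : T.Face → Fin 3 → ℝ) (φ : V → ℝ) :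
    ∑ v, T.cornerSum θ v * φ v = ∑ f, ∑ i, θ f i * φ (T.corner f i) := by
  classical
  simp_rw [cornerSum, Finset.sum_mul]
  rw [Finset.sum_comm]
  refine Finset.sum_congr rfl fun f _ => ?_
  rw [Finset.sum_comm]
  refine Finset.sum_congr rfl fun i _ => ?_
  simp [ite_mul]

namespace PHMetric

variable {T : Triangulation S V} (d : T.PHMetric)

/-- `Real.arccos` is constant beyond `±1`, so one formula also covers degenerate faces. -/
theorem extAngle_eq_hypAngle (u : V → ℝ) (f : T.Face) (i : Fin 3) :
    d.extAngle u f i = hypAngle (d.scaledLength u (T.side f i))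
      (d.scaledLength u (T.side f (i + 1))) (d.scaledLength u (T.side f (i + 2))) :=
  extHypAngle_eq_hypAngle (d.scaledLength_pos _ _) (d.scaledLength_pos _ _)
    (d.scaledLength_pos _ _)

theorem hasDerivAt_scaledLength (u h : V → ℝ) (f : T.Face) (i : Fin 3) (t : ℝ) :
    HasDerivAt (fun s : ℝ => d.scaledLength (u + s • h) (T.side f i))
      (2 * (h (T.corner f (i + 1)) + h (T.corner f (i + 2))) *
        (Real.cosh (d.scaledLength (u + t • h) (T.side f i)) - 1) /
        Real.sinh (d.scaledLength (u + t • h) (T.side f i))) t := by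
  have hk : 0 < Real.sinh (d.length (T.side f i) / 2) :=
    Real.sinh_pos_iff.2 (half_pos (d.length_pos _))
  have e : (fun s : ℝ => d.scaledLength (u + s • h) (T.side f i)) = fun s =>
      2 * Real.arsinh (Real.sinh (d.length (T.side f i) / 2) *
        Real.exp (u (T.corner f (i + 1)) + u (T.corner f (i + 2)) +
          s * (h (T.corner f (i + 1)) + h (T.corner f (i + 2))))) := by
    funext s
    rw [scaledLength, endpoint_add_endpoint]
    simp only [Pi.add_apply, Pi.smul_apply, smul_eq_mul]
    congr 4
    ring
  have := hasDerivAt_two_mul_arsinh hk (u (T.corner f (i + 1)) + u (T.corner f (i + 2)))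
    (h (T.corner f (i + 1)) + h (T.corner f (i + 2))) t
  rw [e]
  exact this.congr_deriv (by rw [← congrFun e t])

/-- The pairing of the extended angles of `u * d` in a face with a variation `h` of the conformal
factor. -/
noncomputable def anglePairing (f : T.Face) (h u : V → ℝ) : ℝ :=
  ∑ i, d.extAngle u f i * h (T.corner f i)

theorem continuous_anglePairing (f : T.Face) (h : V → ℝ) : Continuous (d.anglePairing f h) :=
  continuous_finsetSum _ fun i _ => (d.continuous_extAngle f i).mul continuous_const

/-- The Gram determinant of a face of `u * d`. -/
noncomputable def gram (u : V → ℝ) (f : T.Face) : ℝ :=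
  hypGram (d.scaledLength u (T.side f 0)) (d.scaledLength u (T.side f 1))
    (d.scaledLength u (T.side f 2))

theorem gram_pos {u : V → ℝ} (hu : u ∈ d.admissibleSpace) (f : T.Face) : 0 < d.gram u f :=
  hypGram_pos (d.scaledLength_pos _ _) (d.scaledLength_pos _ _) (d.scaledLength_pos _ _)
    (hu f 0) (hu f 1) (hu f 2)

theorem anglePairing_eq (f : T.Face) (h u : V → ℝ) :
    d.anglePairing f h u =
      hypAngle (d.scaledLength u (T.side f 0)) (d.scaledLength u (T.side f 1))
        (d.scaledLength u (T.side f 2)) * h (T.corner f 0) +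
      hypAngle (d.scaledLength u (T.side f 1)) (d.scaledLength u (T.side f 2))
        (d.scaledLength u (T.side f 0)) * h (T.corner f 1) +
      hypAngle (d.scaledLength u (T.side f 2)) (d.scaledLength u (T.side f 0))
        (d.scaledLength u (T.side f 1)) * h (T.corner f 2) := by
  simp only [anglePairing, Fin.sum_univ_three, extAngle_eq_hypAngle]
  rfl

theorem exists_hasDerivAt_anglePairing_neg (f : T.Face) {u h : V → ℝ} {t : ℝ}
    (hG : 0 < d.gram (u + t • h) f) (hh : ∃ i, h (T.corner f i) ≠ 0) :
    ∃ g' < 0, HasDerivAt (fun s : ℝ => d.anglePairing f h (u + s • h)) g' t := by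
  simp_rw [anglePairing_eq]
  exact exists_hasDerivAt_angles_neg (d.scaledLength_pos _ _) (d.scaledLength_pos _ _)
    (d.scaledLength_pos _ _) (d.hasDerivAt_scaledLength u h f 0 t)
    (d.hasDerivAt_scaledLength u h f 1 t) (d.hasDerivAt_scaledLength u h f 2 t) hG
    (by simpa [Fin.exists_fin_succ] using hh)

theorem anglePairing_mem_of_gram_nonpos (f : T.Face) (h : V → ℝ) {u : V → ℝ}
    (hG : d.gram u f ≤ 0) :
    d.anglePairing f h u ∈ Set.range fun ε : Fin 3 → Bool =>
      ∑ i, (if ε i then Real.pi else 0) * h (T.corner f i) := by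
  have hi (i : Fin 3) : d.extAngle u f i = 0 ∨ d.extAngle u f i = Real.pi := by
    rw [extAngle_eq_hypAngle]
    refine hypAngle_eq_zero_or_pi (d.scaledLength_pos _ _) (d.scaledLength_pos _ _) ?_
    refine le_of_eq_of_le ?_ hG
    fin_cases i
    · rfl
    · exact hypGram_rotate _ _ _
    · exact (hypGram_rotate _ _ _).trans (hypGram_rotate _ _ _)
  -- Not every pattern `ε` need occur; only the finiteness of the range matters.
  refine ⟨fun i => decide (d.extAngle u f i = Real.pi), Finset.sum_congr rfl fun i _ => ?_⟩
  rcases hi i with h0 | h0 <;> simp [h0, Real.pi_ne_zero.symm]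

theorem antitone_anglePairing (f : T.Face) (u h : V → ℝ) :
    Antitone fun s : ℝ => d.anglePairing f h (u + s • h) := by
  by_cases hh : ∃ i, h (T.corner f i) ≠ 0
  · refine antitone_of_hasDerivAt_neg_or_mem_finite
      ((d.continuous_anglePairing f h).comp (by fun_prop)) (Set.finite_range
        fun ε : Fin 3 → Bool => ∑ i, (if ε i then Real.pi else 0) * h (T.corner f i)) fun t => ?_
    rcases le_or_gt (d.gram (u + t • h) f) 0 with hG | hG
    · exact .inl (d.anglePairing_mem_of_gram_nonpos f h hG)
    · exact .inr (d.exists_hasDerivAt_anglePairing_neg f hG hh)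
  · push Not at hh
    intro s t _
    simp [anglePairing, hh]

theorem anglePairing_le (f : T.Face) (u u' : V → ℝ) :
    d.anglePairing f (u' - u) u' ≤ d.anglePairing f (u' - u) u := by
  simpa using d.antitone_anglePairing f u (u' - u) zero_le_one

/-- Admissibility of the starting point alone gives strictness: the pairing drops right after `u`
and, being antitone, never recovers, even if the face degenerates on the way to `u'`. -/
theorem anglePairing_lt (f : T.Face) {u u' : V → ℝ} (hu : u ∈ d.admissibleSpace)
    (h : ∃ i, u' (T.corner f i) ≠ u (T.corner f i)) :
    d.anglePairing f (u' - u) u' < d.anglePairing f (u' - u) u := by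
  obtain ⟨g', hg', hd⟩ := d.exists_hasDerivAt_anglePairing_neg f (u := u) (h := u' - u) (t := 0)
    (by simpa using d.gram_pos hu f) (by simpa [sub_ne_zero] using h)
  obtain ⟨x, hx, hlt⟩ := hd.exists_mem_Ioo_lt_of_neg hg' one_pos
  have := d.antitone_anglePairing f u (u' - u) hx.2.le
  simp only [one_smul, add_sub_cancel, zero_smul, add_zero] at this hlt
  exact this.trans_lt hlt

/-- The extended curvature is strictly monotone at admissible conformal factors. -/
theorem sum_extCurvature_sub_mul_pos {u u' : V → ℝ} (hu : u ∈ d.admissibleSpace) (h : u ≠ u') :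
    0 < ∑ v, (d.extCurvature u' v - d.extCurvature u v) * (u' v - u v) := by
  have e : ∑ v, (d.extCurvature u' v - d.extCurvature u v) * (u' v - u v) =
      ∑ f, d.anglePairing f (u' - u) u - ∑ f, d.anglePairing f (u' - u) u' := by
    simp only [anglePairing]
    rw [← sum_cornerSum_mul, ← sum_cornerSum_mul, ← Finset.sum_sub_distrib]
    refine Finset.sum_congr rfl fun v _ => ?_
    rw [extCurvature, extCurvature, Pi.sub_apply]
    ring
  rw [e, sub_pos]
  -- A vertex where `u` and `u'` differ is a corner of some face, which makes one summand strict.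
  obtain ⟨v, hv⟩ := Function.ne_iff.1 h
  obtain ⟨f, i, hf⟩ := T.exists_corner v v.2
  have hf' : T.corner f i = v := Subtype.ext hf
  exact Finset.sum_lt_sum (fun f _ => d.anglePairing_le f u u')
    ⟨f, Finset.mem_univ f, d.anglePairing_lt f hu ⟨i, by rw [hf']; exact hv.symm⟩⟩

theorem extAlphaCurvature_eq_iff {α r : ℝ} {u : V → ℝ} {v : V} :
    d.extAlphaCurvature α u v = r ↔ d.extCurvature u v = r * Real.exp (α * u v) := by
  rw [extAlphaCurvature, ← Real.exp_mul, mul_comm (u v), div_eq_iff (Real.exp_pos _).ne']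

theorem alphaCurvature_eq (α : ℝ) (u : d.admissibleSpace) (v : V) :
    d.alphaCurvature α u v = d.extAlphaCurvature α u.1 v := by
  rw [alphaCurvature, extAlphaCurvature, extCurvature, extAngle_eq_angle, curvature]

end PHMetric

end Triangulation

/-! ### The sign condition and the conclusion -/

theorem mul_exp_sub_exp_mul_nonpos {α r : ℝ} (h : α * r ≤ 0) (x y : ℝ) :
    (r * Real.exp (α * x) - r * Real.exp (α * y)) * (x - y) ≤ 0 := by
  have hmono : 0 ≤ (Real.exp (α * x) - Real.exp (α * y)) * (α * x - α * y) := by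
    rcases le_total (α * x) (α * y) with hxy | hxy
    · exact mul_nonneg_of_nonpos_of_nonpos (sub_nonpos.2 (Real.exp_le_exp.2 hxy))
        (sub_nonpos.2 hxy)
    · exact mul_nonneg (sub_nonneg.2 (Real.exp_le_exp.2 hxy)) (sub_nonneg.2 hxy)
  rcases eq_or_ne α 0 with rfl | hα
  · simp
  -- The factor `α ^ 2` turns `r` and `x - y` into `α * r` and `α * x - α * y`, which settles both
  -- signs of `α` at once.
  · have e : α ^ 2 * ((r * Real.exp (α * x) - r * Real.exp (α * y)) * (x - y)) =
        (α * r) * ((Real.exp (α * x) - Real.exp (α * y)) * (α * x - α * y)) := by ring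
    refine nonpos_of_mul_nonpos_right ?_ (by positivity : 0 < α ^ 2)
    rw [e]
    exact mul_nonpos_of_nonpos_of_nonneg h hmono

theorem mainTheorem3 {S : Type*} [TopologicalSpace S] [T2Space S] [CompactSpace S]
    [ConnectedSpace S] [ChartedSpace (EuclideanSpace ℝ (Fin 2)) S]
    (V : Finset S) (T : Triangulation S V) (d₀ : T.PHMetric) (α : ℝ) (R : V → ℝ)
    (hR : ∀ v, α * R v ≤ 0) :
    {u : d₀.admissibleSpace | ∀ v, d₀.alphaCurvature α u v = R v}.Subsingleton ∧
    ∀ uA ∈ d₀.admissibleSpace, ∀ uB : V → ℝ,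
      (∀ v, d₀.extAlphaCurvature α uA v = R v) →
      (∀ v, d₀.extAlphaCurvature α uB v = R v) →
      uA = uB := by
  have key : ∀ uA ∈ d₀.admissibleSpace, ∀ uB : V → ℝ,
      (∀ v, d₀.extAlphaCurvature α uA v = R v) →
      (∀ v, d₀.extAlphaCurvature α uB v = R v) → uA = uB := by
    intro uA hA uB hRA hRB
    by_contra hne
    refine (d₀.sum_extCurvature_sub_mul_pos hA hne).not_ge (Finset.sum_nonpos fun v _ => ?_)
    rw [d₀.extAlphaCurvature_eq_iff.1 (hRA v), d₀.extAlphaCurvature_eq_iff.1 (hRB v)]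
    exact mul_exp_sub_exp_mul_nonpos (hR v) _ _
  refine ⟨fun u hu u' hu' => Subtype.ext (key u u.2 u' (fun v => ?_) fun v => ?_), key⟩
  · rw [← d₀.alphaCurvature_eq]
    exact hu v
  · rw [← d₀.alphaCurvature_eq]
    exact hu' v
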